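/- There are universal constants $c, C > 0$ such that the following holds for every integer $n \ge 2$, every $\delta \in \left(0, \min\left(\tfrac1{20}, \tfrac1n\right)\right)$ and every input space $\mathcal X$ with at least $n$ points. There exist distinct points $x_1,\dots,x_n \in \mathcal X$ and a finite class $\mathcal F$ of functions $\mathcal X \to \{-1,1\}$ with the two properties below. Setting: for an unknown labeling $y \in \{-1,1\}^n$, an algorithm (which knows $x_1,\dots,x_n$ and $\mathcal F$) adaptively queries indices $i \in \{1,\dots,n\}$, each time observing $y_i$, until it stops and outputs an element of $\mathcal F$; all queries are counted, including repeated ones. A randomized algorithm may use internal randomness; it is called $\delta$-agnostic if for every labeling $y \in \{-1,1\}^n$, realizable by $\mathcal F$ or not, it stops and outputs an element of $\operatorname{argmin}_{f \in \mathcal F} \sum_{i=1}^n \mathbf 1\{y_i \neq f(x_i)\}$ with probability at least $1-\delta$. The instance of $f \in \mathcal F$ is the labeling $y_i = f(x_i)$, $i = 1,\dots,n$. 1. There is an $f \in \mathcal F$ such that every (possibly randomized) $\delta$-agnostic algorithm makes, on the instance of $f$, an expected number of queries of at least $$c\, \log(1/\delta)\, \frac{\sqrt n}{\log(n/\delta)}.$$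 2. There is a deterministic realizability-based algorithm, i.e. one that is only required to be correct on the instances of elements of $\mathcal F$, that for every $f \in \mathcal F$ outputs exactly $f$ on the instance of $f$ after at most $C \log n$ queries. -/

import Mathlib

open MeasureTheory
open scoped ENNReal

namespace ActiveClassification

universe u v

/-- The output space `{-1, 1}`. -/
abbrev Label : Type := ℤˣ

variable {𝒳 : Type u} {n : ℕ}

/-- The labeling `(f(x₁), …, f(xₙ))` of the pool `x` by the classifier `f`: the realizable
instance that `f` determines. -/
def labels (x : Fin n → 𝒳) (f : 𝒳 → Label) : Fin n → Label := fun i => f (x i)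

/-- The number `∑ᵢ 𝟙{yᵢ ≠ f(xᵢ)}` of errors of the classifier `f` on the labeled pool. -/
def errors (x : Fin n → 𝒳) (y : Fin n → Label) (f : 𝒳 → Label) : ℕ :=
  ∑ i : Fin n, if y i ≠ f (x i) then 1 else 0

/-- `f ∈ argmin_{g ∈ F} ∑ᵢ 𝟙{yᵢ ≠ g(xᵢ)}`. -/
def IsBest (x : Fin n → 𝒳) (F : Set (𝒳 → Label)) (y : Fin n → Label) (f : 𝒳 → Label) : Prop :=
  f ∈ F ∧ ∀ g ∈ F, errors x y f ≤ errors x y g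

/-- A deterministic adaptive algorithm for a class `F` and a pool of `n` points: given the list
(in chronological order) of the queries made so far with the labels observed, it either
queries an index (`Sum.inl i`) or stops and outputs a classifier of the class (`Sum.inr g`). -/
abbrev Strategy (n : ℕ) (F : Set (𝒳 → Label)) : Type u :=
  List (Fin n × Label) → Fin n ⊕ F

namespace Strategy

variable {F : Set (𝒳 → Label)}

/-- The history after `t` rounds of running `s` when the true labels are `y`; it no longer
changes once `s` has stopped. -/
def history (s : Strategy n F) (y : Fin n → Label) : ℕ → List (Fin n × Label)
  | 0 => []
  | t + 1 =>
    match s (history s y t) with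
    | Sum.inl i => history s y t ++ [(i, y i)]
    | Sum.inr _ => history s y t

/-- On the labels `y`, the algorithm `s` stops (after finitely many queries) and outputs `g`. -/
def Outputs (s : Strategy n F) (y : Fin n → Label) (g : 𝒳 → Label) : Prop :=
  ∃ t : ℕ, ∃ h : F, s (s.history y t) = Sum.inr h ∧ (h : 𝒳 → Label) = g

/-- The total number of queries made by `s` on the labels `y`, repeated queries included
(`⊤` if `s` never stops). -/
noncomputable def numQueries (s : Strategy n F) (y : Fin n → Label) : ℕ∞ :=
  ⨆ t : ℕ, ((s.history y t).length : ℕ∞)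

end Strategy

/-- A randomized adaptive algorithm whose internal randomness is a point `ω` of a probability
space `Ω`: for every `ω` a deterministic adaptive algorithm, such that each decision is a random
variable (with values in a discrete space). -/
structure RandomizedAlgorithm (Ω : Type v) [MeasurableSpace Ω] (n : ℕ)
    (F : Set (𝒳 → Label)) where
  strategy : Ω → Strategy n F
  measurableSet_decision : ∀ (h : List (Fin n × Label)) (S : Set (Fin n ⊕ F)),
    MeasurableSet {ω | strategy ω h ∈ S}

namespace RandomizedAlgorithm

variable {Ω : Type v} [MeasurableSpace Ω] {F : Set (𝒳 → Label)}

/-- `A` is `δ`-agnostic: whatever the labeling `y` of the pool, it finds a classifier in `F` with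
the fewest errors with probability at least `1 - δ`. -/
def IsAgnostic (A : RandomizedAlgorithm Ω n F) (P : Measure Ω) (x : Fin n → 𝒳) (δ : ℝ) : Prop :=
  ∀ y : Fin n → Label,
    ENNReal.ofReal (1 - δ) ≤ P {ω | ∃ g, IsBest x F y g ∧ (A.strategy ω).Outputs y g}

/-- The expected number of queries of `A` on the labels `y`. -/
noncomputable def expectedQueries (A : RandomizedAlgorithm Ω n F) (P : Measure Ω)
    (y : Fin n → Label) : ℝ≥0∞ :=
  ∫⁻ ω, ((A.strategy ω).numQueries y : ℝ≥0∞) ∂P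

end RandomizedAlgorithm

end ActiveClassification

/-! The hard instance is the constant classifier `1`. On it `1` is the unique optimum. Flip the
block of one word `w` to `-1`: now `1` makes `L + 1` errors, while the classifier of `w` errs at
most on the `L` code points, so `1` is no longer optimal. The `2 ^ L` blocks are disjoint, and a run
that misses a block cannot notice its flip, so an agnostic algorithm looks into each with
probability at least `1 - 2δ` (`IsAgnostic.le_expectedQueries`). This costs `2 ^ L * (1 - 2δ)`
queries in expectation, of order `√n`. Under realizability, the code points give the word away and
one point of its block tells its classifier from `1` (`readStrategy_spec`): `L + 1` queries, at most
`log₂ n`. -/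

namespace ActiveClassification

universe u v

/-! ### Runs of a deterministic strategy -/

namespace Strategy

variable {𝒳 : Type u} {n : ℕ} {F : Set (𝒳 → Label)}

theorem history_succ_of_inl {s : Strategy n F} {y : Fin n → Label} {t : ℕ} {i : Fin n}
    (h : s (s.history y t) = Sum.inl i) :
    s.history y (t + 1) = s.history y t ++ [(i, y i)] := by
  rw [history, h]

theorem history_succ_of_inr {s : Strategy n F} {y : Fin n → Label} {t : ℕ} {g : F}
    (h : s (s.history y t) = Sum.inr g) : s.history y (t + 1) = s.history y t := by
  rw [history, h]

theorem history_prefix_succ (s : Strategy n F) (y : Fin n → Label) (t : ℕ) :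
    s.history y t <+: s.history y (t + 1) := by
  rcases h : s (s.history y t) with i | g
  · rw [history_succ_of_inl h]
    exact List.prefix_append _ _
  · rw [history_succ_of_inr h]

theorem history_prefix (s : Strategy n F) (y : Fin n → Label) {t t' : ℕ} (h : t ≤ t') :
    s.history y t <+: s.history y t' := by
  induction t', h using Nat.le_induction with
  | base => exact List.prefix_rfl
  | succ k _ ih => exact ih.trans (s.history_prefix_succ y k)

theorem history_eq_of_stopped {s : Strategy n F} {y : Fin n → Label} {t t' : ℕ} {g : F}
    (h : s (s.history y t) = Sum.inr g) (htt : t ≤ t') : s.history y t' = s.history y t := by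
  induction t', htt using Nat.le_induction with
  | base => rfl
  | succ k _ ih => rw [history_succ_of_inr (g := g) (by rw [ih, h]), ih]

/-- A strategy has at most one output on a given labeling. -/
theorem Outputs.unique {s : Strategy n F} {y : Fin n → Label} {g g' : 𝒳 → Label}
    (h : s.Outputs y g) (h' : s.Outputs y g') : g = g' := by
  obtain ⟨t, a, ha, rfl⟩ := h
  obtain ⟨t', a', ha', rfl⟩ := h'
  rcases le_total t t' with htt | htt
  · rw [history_eq_of_stopped ha htt, ha] at ha'
    rw [Sum.inr.inj ha']
  · rw [history_eq_of_stopped ha' htt, ha'] at ha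
    rw [Sum.inr.inj ha]

/-- Two labelings that agree on all queried points yield the same run. -/
theorem history_congr {s : Strategy n F} {y y' : Fin n → Label} {t : ℕ}
    (h : ∀ p ∈ s.history y t, y p.1 = y' p.1) : s.history y' t = s.history y t := by
  induction t with
  | zero => rfl
  | succ t ih =>
    have ih' := ih fun p hp => h p ((s.history_prefix_succ y t).subset hp)
    rcases hs : s (s.history y t) with i | g
    · rw [history_succ_of_inl (i := i) (by rw [ih', hs]), history_succ_of_inl hs, ih']
      rw [history_succ_of_inl hs] at h
      rw [← h (i, y i) (by simp)]
    · rw [history_succ_of_inr (g := g) (by rw [ih', hs]), history_succ_of_inr hs, ih']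

theorem length_history_le_numQueries (s : Strategy n F) (y : Fin n → Label) (t : ℕ) :
    ((s.history y t).length : ℕ∞) ≤ s.numQueries y :=
  le_iSup (fun t => ((s.history y t).length : ℕ∞)) t

theorem numQueries_le_of_stopped {s : Strategy n F} {y : Fin n → Label} {t : ℕ} {g : F}
    (h : s (s.history y t) = Sum.inr g) :
    s.numQueries y ≤ ((s.history y t).length : ℕ∞) := by
  refine iSup_le fun t' => Nat.cast_le.2 ?_
  rcases le_total t t' with htt | htt
  · rw [history_eq_of_stopped h htt]
  · exact (s.history_prefix y htt).length_le

end Strategy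

/-! ### Measurability and the lower bound for agnostic algorithms -/

namespace RandomizedAlgorithm

variable {𝒳 : Type u} {n : ℕ} {F : Set (𝒳 → Label)} {Ω : Type v} [MeasurableSpace Ω]

/-- There are only countably many histories, so splitting by the previous one reduces the event to
single decisions. -/
theorem measurableSet_history_eq (A : RandomizedAlgorithm Ω n F) (y : Fin n → Label) (t : ℕ)
    (l : List (Fin n × Label)) : MeasurableSet {ω | (A.strategy ω).history y t = l} := by
  induction t generalizing l with
  | zero => exact MeasurableSet.const ([] = l)
  | succ t ih =>
    have : {ω | (A.strategy ω).history y (t + 1) = l} =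
        ⋃ l' : List (Fin n × Label), {ω | (A.strategy ω).history y t = l'} ∩
          {ω | A.strategy ω l' ∈ {a : Fin n ⊕ F |
            Sum.elim (fun i => l' ++ [(i, y i)]) (fun _ => l') a = l}} := by
      ext ω
      simp only [Set.mem_ofPred_eq, Set.mem_iUnion, Set.mem_inter_iff, exists_eq_left']
      rcases h : A.strategy ω ((A.strategy ω).history y t) with i | g
      · rw [Strategy.history_succ_of_inl h, Sum.elim_inl]
      · rw [Strategy.history_succ_of_inr h, Sum.elim_inr]
    rw [this]
    exact MeasurableSet.iUnion fun l' => (ih l').inter (A.measurableSet_decision l' _)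

theorem measurableSet_outputs (A : RandomizedAlgorithm Ω n F) (y : Fin n → Label)
    (B : (𝒳 → Label) → Prop) :
    MeasurableSet {ω | ∃ g, B g ∧ (A.strategy ω).Outputs y g} := by
  have : {ω | ∃ g, B g ∧ (A.strategy ω).Outputs y g} =
      ⋃ t : ℕ, ⋃ l : List (Fin n × Label), {ω | (A.strategy ω).history y t = l} ∩
        {ω | A.strategy ω l ∈ {a : Fin n ⊕ F | ∃ h : F, a = Sum.inr h ∧ B h}} := by
    ext ω
    simp only [Set.mem_ofPred_eq, Set.mem_iUnion, Set.mem_inter_iff, exists_eq_left',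
      Strategy.Outputs]
    constructor
    · rintro ⟨_, hB, t, h, hs, rfl⟩
      exact ⟨t, h, hs, hB⟩
    · rintro ⟨t, h, hs, hB⟩
      exact ⟨h, hB, t, h, hs, rfl⟩
  rw [this]
  exact MeasurableSet.iUnion fun t => MeasurableSet.iUnion fun l =>
    (A.measurableSet_history_eq y t l).inter (A.measurableSet_decision l _)

/-- If the best classifiers for `y` are not best for any of the labelings `y' u`, and the `y' u`
differ from `y` on pairwise disjoint sets of points, then a `δ`-agnostic algorithm has to look at
each of these sets with probability at least `1 - 2δ`. -/
theorem IsAgnostic.le_expectedQueries {A : RandomizedAlgorithm Ω n F} {P : Measure Ω}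
    [IsProbabilityMeasure P] {x : Fin n → 𝒳} {δ : ℝ} (hA : A.IsAgnostic P x δ)
    {ι : Type*} [Fintype ι] (y : Fin n → Label) (y' : ι → Fin n → Label)
    (hbest : ∀ u g, IsBest x F y g → ¬ IsBest x F (y' u) g)
    (hdisj : ∀ u v i, y i ≠ y' u i → y i ≠ y' v i → u = v) :
    (Fintype.card ι : ℝ≥0∞) * ENNReal.ofReal (1 - 2 * δ) ≤ A.expectedQueries P y := by
  classical
  let G : (Fin n → Label) → Set Ω := fun z =>
    {ω | ∃ g, IsBest x F z g ∧ (A.strategy ω).Outputs z g}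
  have hG : ∀ z, MeasurableSet (G z) := fun z => A.measurableSet_outputs z _
  -- Union bound over the two failure events.
  have hprob : ∀ u, ENNReal.ofReal (1 - 2 * δ) ≤ P (G y ∩ G (y' u)) := by
    intro u
    have hc : ∀ z, P.real (G z)ᶜ ≤ δ := by
      intro z
      rw [probReal_compl_eq_one_sub (hG z)]
      have := (ENNReal.ofReal_le_iff_le_toReal (measure_ne_top P _)).1 (hA z)
      change 1 - δ ≤ P.real (G z) at this
      linarith
    have h1 : P.real (G y ∩ G (y' u))ᶜ ≤ P.real (G y)ᶜ + P.real (G (y' u))ᶜ := by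
      rw [Set.compl_inter]
      exact measureReal_union_le _ _
    rw [probReal_compl_eq_one_sub ((hG y).inter (hG (y' u)))] at h1
    refine (ENNReal.ofReal_le_iff_le_toReal (measure_ne_top P _)).2 ?_
    change 1 - 2 * δ ≤ P.real _
    linarith [hc y, hc (y' u)]
  have hcount : ∀ ω, ∑ u, (G y ∩ G (y' u)).indicator (1 : Ω → ℝ≥0∞) ω ≤
      ((A.strategy ω).numQueries y : ℝ≥0∞) := by
    intro ω
    by_cases hω : ω ∈ G y
    swap
    · simp [hω]
    obtain ⟨_, hg, t, g, hs, rfl⟩ := hω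
    let U := Finset.univ.filter fun u => ω ∈ G y ∩ G (y' u)
    -- Otherwise the runs on `y` and `y' u` coincide and share an output that is best for both
    -- labelings.
    have hquery : ∀ u ∈ U, ∃ i ∈ ((A.strategy ω).history y t).map Prod.fst, y i ≠ y' u i := by
      intro u hu
      by_contra! hno
      obtain ⟨g', hg', ho'⟩ := (Finset.mem_filter.1 hu).2.2
      have hrun : (A.strategy ω).history (y' u) t = (A.strategy ω).history y t :=
        Strategy.history_congr fun p hp => hno _ (List.mem_map_of_mem hp)
      have ho : (A.strategy ω).Outputs (y' u) g := ⟨t, g, by rw [hrun, hs], rfl⟩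
      rw [ho'.unique ho] at hg'
      exact hbest u g hg hg'
    -- By disjointness each queried index accounts for at most one `u`.
    have hcard : U.card ≤ ((A.strategy ω).history y t).length := by
      calc U.card ≤ (((A.strategy ω).history y t).map Prod.fst).toFinset.card :=
            Finset.card_le_card_of_forall_subsingleton (fun u i => y i ≠ y' u i)
              (fun u hu => by simpa only [List.mem_toFinset] using hquery u hu)
              fun i _ u hu v hv => hdisj u v i hu.2 hv.2
        _ ≤ _ := (List.toFinset_card_le _).trans_eq (List.length_map _)
    calc ∑ u, (G y ∩ G (y' u)).indicator (1 : Ω → ℝ≥0∞) ω = (U.card : ℝ≥0∞) := by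
          simp [U, Set.indicator_apply]
      _ ≤ ((((A.strategy ω).history y t).length : ℕ∞) : ℝ≥0∞) := by
          rw [ENat.toENNReal_coe]
          exact_mod_cast hcard
      _ ≤ _ := ENat.toENNReal_le.2 (Strategy.length_history_le_numQueries _ _ _)
  calc (Fintype.card ι : ℝ≥0∞) * ENNReal.ofReal (1 - 2 * δ)
      = ∑ _u : ι, ENNReal.ofReal (1 - 2 * δ) := by simp
    _ ≤ ∑ u, P (G y ∩ G (y' u)) := Finset.sum_le_sum fun u _ => hprob u
    _ = ∑ u, ∫⁻ ω, (G y ∩ G (y' u)).indicator (1 : Ω → ℝ≥0∞) ω ∂P := by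
        simp only [lintegral_indicator_one ((hG y).inter (hG _))]
    _ = ∫⁻ ω, ∑ u, (G y ∩ G (y' u)).indicator (1 : Ω → ℝ≥0∞) ω ∂P :=
        (lintegral_finsetSum _ fun u _ =>
          measurable_one.indicator ((hG y).inter (hG (y' u)))).symm
    _ ≤ A.expectedQueries P y := lintegral_mono hcount

end RandomizedAlgorithm

/-! ### The hard class

The pool contains `L` code points and, for every code word `w ∈ {-1, 1}^L`, a block of `L + 1`
points. Besides the constant classifier `1`, the class contains for every `w` the classifier that
spells `w` on the code points, is `-1` on the block of `w`, and is `1` elsewhere. -/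

/-- Code points and blocks. -/
abbrev CodeBlock (L : ℕ) : Type := Fin L ⊕ ((Fin L → Label) × Fin (L + 1))

/-- The labels that the classifier with code word `w` gives to code points and blocks. -/
def wordLabel {L : ℕ} (w : Fin L → Label) : CodeBlock L → Label :=
  Sum.elim w fun p => if p.1 = w then -1 else 1

/-- The classifier with code word `w`. -/
noncomputable def wordClassifier {𝒳 : Type u} {L : ℕ} (φ : CodeBlock L → 𝒳) (w : Fin L → Label) :
    𝒳 → Label :=
  Function.extend φ (wordLabel w) 1

/-- The class of all word classifiers and the constant `1`. -/
def wordClass {𝒳 : Type u} {L : ℕ} (φ : CodeBlock L → 𝒳) : Set (𝒳 → Label) :=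
  insert 1 (Set.range (wordClassifier φ))

/-- The labeling that is `-1` exactly on the block of `w`. -/
noncomputable def blockLabeling {n L : ℕ} (e : CodeBlock L → Fin n) (w : Fin L → Label) :
    Fin n → Label :=
  Function.extend e (Sum.elim 1 fun p => if p.1 = w then -1 else 1) 1

section

variable {𝒳 : Type u} {n L : ℕ}

theorem wordClassifier_apply {φ : CodeBlock L → 𝒳} (hφ : φ.Injective) (w : Fin L → Label)
    (k : CodeBlock L) : wordClassifier φ w (φ k) = wordLabel w k :=
  hφ.extend_apply _ _ _

theorem wordClass_finite (φ : CodeBlock L → 𝒳) : (wordClass φ).Finite :=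
  (Set.finite_range _).insert _

theorem blockLabeling_inr {e : CodeBlock L → Fin n} (he : e.Injective) (w : Fin L → Label)
    (p : (Fin L → Label) × Fin (L + 1)) :
    blockLabeling e w (e (Sum.inr p)) = if p.1 = w then -1 else 1 :=
  he.extend_apply _ _ _

theorem eq_of_blockLabeling_ne_one {e : CodeBlock L → Fin n} (he : e.Injective)
    {w : Fin L → Label} {i : Fin n} (h : 1 ≠ blockLabeling e w i) :
    ∃ k, i = e (Sum.inr (w, k)) := by
  by_cases hi : ∃ a, e a = i
  · obtain ⟨a, rfl⟩ := hi
    rw [blockLabeling, he.extend_apply] at h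
    rcases a with j | ⟨v, k⟩
    · simp at h
    · by_cases hv : v = w
      · exact ⟨k, by rw [hv]⟩
      · simp [hv] at h
  · rw [blockLabeling, Function.extend_apply' _ _ _ hi] at h
    exact absurd rfl h

/-! ### Error counts and optimal classifiers -/

theorem errors_eq_card (x : Fin n → 𝒳) (y : Fin n → Label) (f : 𝒳 → Label) :
    errors x y f = (Finset.univ.filter fun i => y i ≠ f (x i)).card := by
  rw [errors, Finset.card_filter]

theorem errors_blockLabeling_one {e : CodeBlock L → Fin n} (he : e.Injective) (x : Fin n → 𝒳)
    (w : Fin L → Label) : L + 1 ≤ errors x (blockLabeling e w) 1 := by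
  rw [errors_eq_card]
  calc L + 1 = (Finset.univ.image fun k : Fin (L + 1) => e (Sum.inr (w, k))).card := by
        rw [Finset.card_image_of_injective _ fun a b h => by simpa using he h]
        simp
    _ ≤ _ := Finset.card_le_card fun i hi => by
        obtain ⟨k, -, rfl⟩ := Finset.mem_image.1 hi
        simp [blockLabeling_inr he]

theorem errors_blockLabeling_wordClassifier {e : CodeBlock L → Fin n} (he : e.Injective)
    {x : Fin n → 𝒳} (hx : x.Injective) (w : Fin L → Label) :
    errors x (blockLabeling e w) (wordClassifier (x ∘ e) w) ≤ L := by
  rw [errors_eq_card]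
  calc _ ≤ (Finset.univ.image fun j : Fin L => e (Sum.inl j)).card :=
        Finset.card_le_card fun i hi => by
          rw [Finset.mem_filter] at hi
          have hi := hi.2
          by_cases h : ∃ a, e a = i
          · obtain ⟨a, rfl⟩ := h
            rcases a with j | p
            · simp
            · rw [blockLabeling_inr he, ← Function.comp_apply (f := x) (g := e),
                wordClassifier_apply (hx.comp he)] at hi
              exact absurd rfl hi
          -- Off the image of `e`, labeling and classifier both default to `1`.
          · have h' : ¬ ∃ a, (x ∘ e) a = x i := fun ⟨a, ha⟩ => h ⟨a, hx ha⟩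
            rw [blockLabeling, wordClassifier, Function.extend_apply' _ _ _ h,
              Function.extend_apply' _ _ _ h'] at hi
            exact absurd rfl hi
    _ ≤ _ := Finset.card_image_le.trans_eq (by simp)

theorem one_notMem_isBest_blockLabeling {e : CodeBlock L → Fin n} (he : e.Injective)
    {x : Fin n → 𝒳} (hx : x.Injective) (w : Fin L → Label) :
    ¬ IsBest x (wordClass (x ∘ e)) (blockLabeling e w) 1 := fun h => by
  have h1 := h.2 _ (Set.mem_insert_of_mem _ ⟨w, rfl⟩)
  have h2 := errors_blockLabeling_one he x w
  have h3 := errors_blockLabeling_wordClassifier he hx w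
  omega

/-- Every word classifier, even that of the all-ones word, errs on its nonempty block. -/
theorem eq_one_of_isBest_one {e : CodeBlock L → Fin n} (he : e.Injective)
    {x : Fin n → 𝒳} (hx : x.Injective) {g : 𝒳 → Label}
    (h : IsBest x (wordClass (x ∘ e)) 1 g) : g = 1 := by
  obtain ⟨rfl | ⟨w, rfl⟩, hmin⟩ := h
  · rfl
  · have h1 := hmin 1 (Set.mem_insert _ _)
    have h0 : errors x 1 (1 : 𝒳 → Label) = 0 := by simp [errors]
    rw [h0, Nat.le_zero, errors_eq_card, Finset.card_eq_zero, Finset.filter_eq_empty_iff] at h1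
    have h2 := h1 (Finset.mem_univ (e (Sum.inr (w, 0))))
    rw [← Function.comp_apply (f := x) (g := e), wordClassifier_apply (hx.comp he)] at h2
    simp [wordLabel] at h2

/-- The code word read off the first `L` entries of a history. -/
def readWord (L : ℕ) (h : List (Fin n × Label)) : Fin L → Label :=
  fun j => ((h[(j : ℕ)]?).map Prod.snd).getD 1

/-- Read the code word, then look at one point of its block. -/
noncomputable def readStrategy (e : CodeBlock L → Fin n) (φ : CodeBlock L → 𝒳) :
    Strategy n (wordClass φ) := fun h =>
  if hl : h.length < L then Sum.inl (e (Sum.inl ⟨h.length, hl⟩))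
  else if h.length = L then Sum.inl (e (Sum.inr (readWord L h, 0)))
  else if (h[L]?).map Prod.snd = some 1 then Sum.inr ⟨1, Set.mem_insert _ _⟩
  else Sum.inr ⟨wordClassifier φ (readWord L h), Set.mem_insert_of_mem _ ⟨_, rfl⟩⟩

/-- Up to round `L` the length of the history serves as the counter of code points read. -/
theorem readStrategy_history_eq (e : CodeBlock L → Fin n) (φ : CodeBlock L → 𝒳)
    (y : Fin n → Label) (t : ℕ) (ht : t ≤ L) :
    ((readStrategy e φ).history y t).length = t ∧
      ∀ j : Fin L, (j : ℕ) < t →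
        (((readStrategy e φ).history y t)[(j : ℕ)]?).map Prod.snd =
          some (y (e (Sum.inl j))) := by
  induction t with
  | zero => simp [Strategy.history]
  | succ t ih =>
    obtain ⟨hlen, hj⟩ := ih (by omega)
    have hs : readStrategy e φ ((readStrategy e φ).history y t) =
        Sum.inl (e (Sum.inl ⟨t, ht⟩)) := by
      have : ((readStrategy e φ).history y t).length < L := by omega
      rw [readStrategy, dif_pos this]
      simp only [hlen]
    rw [Strategy.history_succ_of_inl hs]
    refine ⟨by simp [hlen], fun j hjt => ?_⟩
    rcases Nat.lt_succ_iff_lt_or_eq.1 hjt with hlt | heq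
    · rw [List.getElem?_append_left (by omega), hj j hlt]
    · obtain rfl : j = ⟨t, ht⟩ := Fin.ext heq
      simp [hlen]

/-- After `L + 1` queries, `readStrategy` knows the labels of the code points and of one point of
the block that these labels designate. -/
theorem readStrategy_stops (e : CodeBlock L → Fin n) (φ : CodeBlock L → 𝒳) (y : Fin n → Label)
    {w : Fin L → Label} (hw : ∀ j, y (e (Sum.inl j)) = w j) :
    ((readStrategy e φ).history y (L + 1)).length = L + 1 ∧
      readStrategy e φ ((readStrategy e φ).history y (L + 1)) =
        if y (e (Sum.inr (w, 0))) = 1 then Sum.inr ⟨1, Set.mem_insert _ _⟩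
        else Sum.inr ⟨wordClassifier φ w, Set.mem_insert_of_mem _ ⟨_, rfl⟩⟩ := by
  obtain ⟨hlen, hj⟩ := readStrategy_history_eq e φ y L le_rfl
  -- The suffix `l` lets this serve both before and after the block query.
  have hword : ∀ l, readWord L ((readStrategy e φ).history y L ++ l) = w := by
    intro l
    funext j
    rw [readWord, List.getElem?_append_left (by omega), hj j j.2, hw, Option.getD_some]
  have hs : readStrategy e φ ((readStrategy e φ).history y L) = Sum.inl (e (Sum.inr (w, 0))) := by
    have hword0 := hword []
    rw [List.append_nil] at hword0
    rw [readStrategy, dif_neg (by omega), if_pos hlen, hword0]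
  rw [Strategy.history_succ_of_inl hs]
  have hlen' : ((readStrategy e φ).history y L ++
      [(e (Sum.inr (w, 0)), y (e (Sum.inr (w, 0))))]).length = L + 1 := by simp [hlen]
  refine ⟨hlen', ?_⟩
  rw [readStrategy, dif_neg (by omega), if_neg (by omega), List.getElem?_append_right (by omega)]
  simp only [hword, hlen, Nat.sub_self, List.getElem?_cons_zero, Option.map_some,
    Option.some.injEq]

theorem readStrategy_spec {e : CodeBlock L → Fin n} (he : e.Injective) {x : Fin n → 𝒳}
    (hx : x.Injective) {f : 𝒳 → Label} (hf : f ∈ wordClass (x ∘ e)) :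
    (readStrategy e (x ∘ e)).Outputs (labels x f) f ∧
      (readStrategy e (x ∘ e)).numQueries (labels x f) ≤ ((L + 1 : ℕ) : ℕ∞) := by
  suffices h : ∃ g : wordClass (x ∘ e), (g : 𝒳 → Label) = f ∧
      ((readStrategy e (x ∘ e)).history (labels x f) (L + 1)).length = L + 1 ∧
      readStrategy e (x ∘ e) ((readStrategy e (x ∘ e)).history (labels x f) (L + 1)) =
        Sum.inr g by
    obtain ⟨g, hg, hlen, hs⟩ := h
    exact ⟨⟨L + 1, g, hs, hg⟩, (Strategy.numQueries_le_of_stopped hs).trans_eq (by rw [hlen])⟩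
  rcases hf with rfl | ⟨w, rfl⟩
  -- The constant spells the all-ones word; only the block query separates it from that word's
  -- classifier.
  · obtain ⟨hlen, hs⟩ := readStrategy_stops e (x ∘ e) (labels x 1) (w := 1) fun j => rfl
    exact ⟨_, rfl, hlen, hs.trans (if_pos rfl)⟩
  · have hlab : ∀ k, labels x (wordClassifier (x ∘ e) w) (e k) = wordLabel w k :=
      fun k => wordClassifier_apply (hx.comp he) w k
    obtain ⟨hlen, hs⟩ := readStrategy_stops e (x ∘ e) (labels x (wordClassifier (x ∘ e) w))
      (w := w) fun j => hlab _
    refine ⟨_, rfl, hlen, hs.trans (if_neg ?_)⟩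
    rw [hlab]
    simp [wordLabel]

end

/-- A suitable code length for a pool of `n` points. -/
theorem exists_codeLength {n : ℕ} (hn : 2 ≤ n) :
    ∃ L : ℕ, Fintype.card (CodeBlock L) ≤ n ∧ n ≤ 9 * (2 ^ L) ^ 2 ∧ L + 1 ≤ Nat.log 2 n := by
  have hlog : 1 ≤ Nat.log 2 n := Nat.log_pos (by norm_num) hn
  -- This choice gives `2L + 1 ≤ Nat.log 2 n ≤ 2L + 2`, hence `2 * 4 ^ L ≤ n < 8 * 4 ^ L`.
  refine ⟨(Nat.log 2 n - 1) / 2, ?_, ?_, by omega⟩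
  all_goals set L := (Nat.log 2 n - 1) / 2 with hL
  · have h1 : 2 ^ (2 * L + 1) ≤ n :=
      (Nat.pow_le_pow_right (by norm_num) (by omega)).trans (Nat.pow_log_le_self 2 (by omega))
    have h2 : L + 1 ≤ 2 ^ L := Nat.lt_two_pow_self
    have hcard : Fintype.card (CodeBlock L) = L + 2 ^ L * (L + 1) := by
      simp [CodeBlock, Fintype.card_units_int]
    rw [hcard]
    rw [pow_succ, mul_comm 2 L, pow_mul] at h1
    nlinarith
  · have h1 : n < 2 ^ (2 * L + 3) :=
      (Nat.lt_pow_succ_log_self (by norm_num) n).trans_le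
        (Nat.pow_le_pow_right (by norm_num) (by omega))
    rw [pow_add, mul_comm 2 L, pow_mul] at h1
    omega

end ActiveClassification

open ActiveClassification

theorem proposition1 :
    ∃ c : ℝ, 0 < c ∧ ∃ C : ℝ, 0 < C ∧
      ∀ (n : ℕ), 2 ≤ n → ∀ δ : ℝ, 0 < δ → δ < min (1 / 20) (1 / (n : ℝ)) →
      ∀ 𝒳 : Type*, Nonempty (Fin n ↪ 𝒳) →
      ∃ (x : Fin n → 𝒳) (F : Set (𝒳 → ActiveClassification.Label)),
        Function.Injective x ∧ F.Finite ∧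
        -- agnostic lower bound, on one realizable instance
        (∃ f ∈ F,
          ∀ (Ω : Type*) [MeasurableSpace Ω] (P : Measure Ω) [IsProbabilityMeasure P]
            (A : ActiveClassification.RandomizedAlgorithm Ω n F), A.IsAgnostic P x δ →
            ENNReal.ofReal (c * (Real.log (1 / δ) * (√(n : ℝ) / Real.log (n / δ)))) ≤
              A.expectedQueries P (ActiveClassification.labels x f)) ∧
        -- a deterministic algorithm that is correct on every realizable instance
        (∃ s : ActiveClassification.Strategy n F, ∀ f ∈ F,
          s.Outputs (ActiveClassification.labels x f) f ∧
          (s.numQueries (ActiveClassification.labels x f) : ℝ≥0∞) ≤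
            ENNReal.ofReal (C * Real.log n)) := by
  -- `1 / 4` is below `(1 / 3) * (9 / 10)`, from `√n ≤ 3 * 2 ^ L` and `1 - 2δ > 9 / 10`; `2` exceeds
  -- `1 / log 2`.
  refine ⟨1 / 4, by norm_num, 2, by norm_num, fun n hn δ hδ0 hδ 𝒳 ⟨x⟩ => ?_⟩
  obtain ⟨L, hcard, hlower, hupper⟩ := exists_codeLength hn
  obtain ⟨e⟩ : Nonempty (CodeBlock L ↪ Fin n) :=
    Function.Embedding.nonempty_of_card_le (by simpa using hcard)
  have hδ20 : δ < 1 / 20 := hδ.trans_le (min_le_left _ _)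
  have hn1 : (1 : ℝ) ≤ n := by exact_mod_cast (by omega : 1 ≤ n)
  refine ⟨x, wordClass (x ∘ e), x.injective, wordClass_finite _,
    ⟨1, Set.mem_insert _ _, fun Ω _ P _ A hA => ?_⟩,
    readStrategy e (x ∘ e), fun f hf => ?_⟩
  · have hbound := hA.le_expectedQueries (labels x 1) (blockLabeling e)
      (fun w g hg => eq_one_of_isBest_one e.injective x.injective hg ▸
        one_notMem_isBest_blockLabeling e.injective x.injective w)
      (fun u v i hu hv => by
        obtain ⟨k, rfl⟩ := eq_of_blockLabeling_ne_one e.injective hu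
        obtain ⟨k', h⟩ := eq_of_blockLabeling_ne_one e.injective hv
        simpa using congrArg (Option.map Prod.fst ∘ Sum.getRight?) (e.injective h))
    refine le_trans ?_ hbound
    have hι : Fintype.card (Fin L → Label) = 2 ^ L := by simp [Fintype.card_units_int]
    rw [hι, ← ENNReal.ofReal_natCast, ← ENNReal.ofReal_mul (by positivity)]
    refine ENNReal.ofReal_le_ofReal ?_
    have hsqrt : √(n : ℝ) ≤ 3 * 2 ^ L := by
      refine Real.sqrt_le_iff.2 ⟨by positivity, ?_⟩
      have : (n : ℝ) ≤ 9 * (2 ^ L) ^ 2 := by exact_mod_cast hlower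
      linarith
    have hlogpos : 0 < Real.log (1 / δ) :=
      Real.log_pos (by rw [lt_div_iff₀ hδ0]; linarith)
    have hloglog : Real.log (1 / δ) ≤ Real.log (n / δ) :=
      Real.log_le_log (by positivity) (by gcongr)
    -- The quotient of logarithms is at most `1`, so a bound of order `√n` is more than enough.
    have hratio : Real.log (1 / δ) * (√(n : ℝ) / Real.log (n / δ)) ≤ √(n : ℝ) := by
      rw [← mul_div_assoc, div_le_iff₀ (hlogpos.trans_le hloglog), mul_comm]
      gcongr
    push_cast
    have h2 : (0 : ℝ) < 2 ^ L := by positivity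
    nlinarith
  · obtain ⟨hout, hnum⟩ := readStrategy_spec e.injective x.injective hf
    refine ⟨hout, (ENat.toENNReal_le.2 hnum).trans ?_⟩
    rw [ENat.toENNReal_coe, ← ENNReal.ofReal_natCast]
    refine ENNReal.ofReal_le_ofReal ?_
    have h1 : ((L + 1 : ℕ) : ℝ) ≤ Real.logb 2 n :=
      (Nat.cast_le.2 hupper).trans (Real.natLog_le_logb n 2)
    have h2 : Real.logb 2 n * Real.log 2 = Real.log n :=
      div_mul_cancel₀ _ (Real.log_pos (by norm_num)).ne'
    have h3 : 0 ≤ Real.logb 2 n := (Nat.cast_nonneg _).trans h1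
    nlinarith [Real.log_two_gt_d9]
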